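/- Let $2<p\le 3$, let $A$ and $B$ be positive real numbers, and let $X$ be a real random variable with $\mathsf E|X|^p<\infty$ (the condition $\mathsf EX=0$ is not needed). Let $\mathcal X_{=}$ denote the class of all finite sequences $(X_1,\dots,X_n)$ (with any $n$) of zero-mean random variables such that $X_1,\dots,X_n$ are independent, $(X_1,\dots,X_n)$ is independent of $X$, and $$\sum_{i=1}^n \mathsf E X_i^2 = B,\qquad \sum_{i=1}^n \mathsf E|X_i|^p = A;$$ let $\mathcal X_{\le}$ denote the class defined in the same way but with $\sum_{i=1}^n \mathsf E X_i^2\le B$ and $\sum_{i=1}^n \mathsf E|X_i|^p\le A$ in place of the two equalities. (Here the underlying probability space is not fixed: the suprema below are over all such sequences on all probability spaces carrying a copy of $X$.) Then $$\sup_{(X_1,\dots,X_n)\in\mathcal X_{\le}}\mathsf E|X+X_1+\dots+X_n|^p=\sup_{(X_1,\dots,X_n)\in\mathcal X_{=}}\mathsf E|X+X_1+\dots+X_n|^p=A+\mathsf E|X+B^{1/2}Z|^p<\infty,$$ where $Z$ is a standard normal random variable independent of $X$. -/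

import Mathlib

open MeasureTheory ProbabilityTheory

universe u

/-- `Y = (Y₁, …, Yₙ)` is a finite sequence of independent zero-mean random variables with finite
absolute moments of order `p` on the probability space `(Ω, P)`. (For `p > 2` on a probability
space, all the integrals below of `Y i`, `(Y i) ^ 2`, `|Y i| ^ p` are then genuine, finite
expectations.) -/
structure IsCenteredIndepSeq {Ω : Type u} [MeasurableSpace Ω] (P : Measure Ω) (p : ℝ)
    {n : ℕ} (Y : Fin n → Ω → ℝ) : Prop where
  memLp : ∀ i, MemLp (Y i) (ENNReal.ofReal p) P
  mean_zero : ∀ i, ∫ ω, Y i ω ∂P = 0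
  indep : iIndepFun Y P

/-- The sequences with `∑ E Yᵢ² = B` and `∑ E |Yᵢ|ᵖ = A`. -/
structure IsRosenthalEq {Ω : Type u} [MeasurableSpace Ω] (P : Measure Ω) (p A B : ℝ)
    {n : ℕ} (Y : Fin n → Ω → ℝ) : Prop extends IsCenteredIndepSeq P p Y where
  sum_sq : ∑ i, ∫ ω, (Y i ω) ^ 2 ∂P = B
  sum_abs_rpow : ∑ i, ∫ ω, |Y i ω| ^ p ∂P = A

/-- The sequences with `∑ E Yᵢ² ≤ B` and `∑ E |Yᵢ|ᵖ ≤ A`. -/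
structure IsRosenthalLe {Ω : Type u} [MeasurableSpace Ω] (P : Measure Ω) (p A B : ℝ)
    {n : ℕ} (Y : Fin n → Ω → ℝ) : Prop extends IsCenteredIndepSeq P p Y where
  sum_sq : ∑ i, ∫ ω, (Y i ω) ^ 2 ∂P ≤ B
  sum_abs_rpow : ∑ i, ∫ ω, |Y i ω| ^ p ∂P ≤ A

/-- All values `E |X + Y₁ + … + Yₙ|ᵖ`, where `(Y₁, …, Yₙ)` is independent of `X` and satisfies the
two equality constraints. Since the space on which `X` was given need not carry further random
variables independent of `X`, all probability spaces with a copy `X'` of `X` are allowed. -/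
def momentValuesEq {Ω : Type u} [MeasurableSpace Ω] (P : Measure Ω) (X : Ω → ℝ) (p A B : ℝ) :
    Set ℝ :=
  {r | ∃ (Ω' : Type u) (_ : MeasurableSpace Ω') (P' : Measure Ω') (X' : Ω' → ℝ)
      (n : ℕ) (Y : Fin n → Ω' → ℝ),
      IsProbabilityMeasure P' ∧ IdentDistrib X' X P' P ∧ IsRosenthalEq P' p A B Y ∧
      IndepFun X' (fun ω i => Y i ω) P' ∧
      r = ∫ ω, |X' ω + ∑ i, Y i ω| ^ p ∂P'}

/-- The same set of values under the two inequality constraints. -/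
def momentValuesLe {Ω : Type u} [MeasurableSpace Ω] (P : Measure Ω) (X : Ω → ℝ) (p A B : ℝ) :
    Set ℝ :=
  {r | ∃ (Ω' : Type u) (_ : MeasurableSpace Ω') (P' : Measure Ω') (X' : Ω' → ℝ)
      (n : ℕ) (Y : Fin n → Ω' → ℝ),
      IsProbabilityMeasure P' ∧ IdentDistrib X' X P' P ∧ IsRosenthalLe P' p A B Y ∧
      IndepFun X' (fun ω i => Y i ω) P' ∧
      r = ∫ ω, |X' ω + ∑ i, Y i ω| ^ p ∂P'}

/-! The heart is a comparison for one summand: if `Y` is centered and `G` is a centered Gaussian of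
the same variance `v`, then `E|x + Y|^p ≤ E|Y|^p + E|x + G|^p` for every real `x`
(`integral_abs_const_add_rpow_le`). For `x > 0`, both `E|x + Y|^p - E|Y|^p` and `E|x + G|^p` are
measured against the Taylor value `x^p + p(p-1)/2 * x^(p-2) * v`. Put `t = v / x^2` and `K =
p(p-1)(2 - 2^(p-2)) x^p`. The first quantity falls short by at least `K t^(3/2) / 6` if `t ≤ 1` and
by at least `K (t/4 - 1/12)` if `t ≥ 1` (`one_add_abs_rpow_sub_ge`); the Gaussian one falls short by
at most `K t^2 / 8` and at most `K t / 6` (`symm_abs_rpow_ge`). The first deficit dominates in both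
ranges. Both estimates come from integrating twice elementary inequalities for the exponent `q = p -
2` in `(0, 1]`.

Replacing the summands by Gaussians one at a time, in Lindeberg's manner, costs `E|Yᵢ|^p` each;
Jensen's inequality then raises the Gaussian variance to `B`. This is the upper bound.

For sharpness, take many small Gaussians, whose total `p`-th moment is negligible because `p > 2`,
and one rare large symmetric jump, which carries almost all of `A` with almost no variance. -/

/-! ### One-variable calculus: exponents in `(0, 1]`, and integration of second-derivative bounds.
-/

theorem le_of_hasDerivAt_nonneg {f f' : ℝ → ℝ} {a b : ℝ} (hab : a ≤ b)
    (hf : ContinuousOn f (Set.Icc a b)) (hd : ∀ x ∈ Set.Ioo a b, HasDerivAt f (f' x) x)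
    (h : ∀ x ∈ Set.Ioo a b, 0 ≤ f' x) : f a ≤ f b := by
  have hm : MonotoneOn f (Set.Icc a b) := by
    apply monotoneOn_of_deriv_nonneg (convex_Icc a b) hf
    · intro x hx
      rw [interior_Icc] at hx
      exact (hd x hx).differentiableAt.differentiableWithinAt
    · intro x hx
      rw [interior_Icc] at hx
      rw [(hd x hx).deriv]
      exact h x hx
  exact hm (Set.left_mem_Icc.2 hab) (Set.right_mem_Icc.2 hab) hab

theorem le_of_hasDerivAt_nonneg' {f f' : ℝ → ℝ} {a b : ℝ} (hab : a ≤ b)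
    (hd : ∀ x ∈ Set.Icc a b, HasDerivAt f (f' x) x)
    (h : ∀ x ∈ Set.Ioo a b, 0 ≤ f' x) : f a ≤ f b :=
  le_of_hasDerivAt_nonneg hab (fun x hx => (hd x hx).continuousAt.continuousWithinAt)
    (fun x hx => hd x (Set.Ioo_subset_Icc_self hx)) h

theorem hasDerivAt_abs_rpow_mul_self {q : ℝ} (hq : 0 < q) (x : ℝ) :
    HasDerivAt (fun x : ℝ => |x| ^ q * x) ((q + 1) * |x| ^ q) x := by
  rcases eq_or_ne x 0 with rfl | hx
  · rw [hasDerivAt_iff_tendsto_slope]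
    have h0 : Filter.Tendsto (fun y : ℝ => |y| ^ q) (nhdsWithin 0 {0}ᶜ) (nhds 0) := by
      have : Continuous fun y : ℝ => |y| ^ q := continuous_abs.rpow_const (fun _ => Or.inr hq.le)
      have := this.tendsto 0
      simp only [abs_zero, Real.zero_rpow hq.ne'] at this
      exact this.mono_left nhdsWithin_le_nhds
    simp only [abs_zero, Real.zero_rpow hq.ne', mul_zero]
    refine h0.congr' ?_
    filter_upwards [self_mem_nhdsWithin] with y hy
    have hy : y ≠ 0 := hy
    simp [slope_def_field, hy]
  · have h1 := ((hasDerivAt_abs hx).rpow_const (p := q) (Or.inl (abs_ne_zero.2 hx))).mul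
      (hasDerivAt_id x)
    refine h1.congr_deriv ?_
    have h2 : |x| ^ q = |x| ^ (q - 1) * |x| := by
      rw [← Real.rpow_add_one (abs_ne_zero.2 hx)]; ring_nf
    have h3 : (SignType.sign x : ℝ) * x = |x| := sign_mul_self x
    simp only [id, mul_one]
    rw [h2, ← h3]
    ring

/-- For `r ∈ [0, 1]` the function `(1 + r) ^ q + (1 - r) ^ q` lies above its chord in `r ^ 2`. -/
theorem chord_le_one_add_rpow_add_one_sub_rpow {q r : ℝ} (hq : 0 < q) (hq1 : q ≤ 1) (hr : 0 ≤ r)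
    (hr1 : r ≤ 1) : 2 - (2 - 2 ^ q) * r ^ 2 ≤ (1 + r) ^ q + (1 - r) ^ q := by
  rcases hr.eq_or_lt with rfl | hr
  · norm_num
  have hdp : ∀ s : ℝ, ∀ x ∈ Set.Ico (0 : ℝ) 1,
      HasDerivAt (fun x : ℝ => (1 + x) ^ s) (s * (1 + x) ^ (s - 1)) x := fun s x hx => by
    have := ((hasDerivAt_id x).const_add 1).rpow_const (p := s)
      (Or.inl (by simp only [id]; linarith [hx.1]))
    simpa using this
  have hdm : ∀ s : ℝ, ∀ x ∈ Set.Ico (0 : ℝ) 1,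
      HasDerivAt (fun x : ℝ => (1 - x) ^ s) (-(s * (1 - x) ^ (s - 1))) x := fun s x hx => by
    have := ((hasDerivAt_id x).const_sub 1).rpow_const (p := s)
      (Or.inl (by simp only [id]; linarith [hx.2]))
    simpa using this
  -- Write `g x = (1 + x)^q + (1 - x)^q`. The expression in `hN` is the numerator of the derivative
  -- of `(2 - g x) / x^2`, and `q` times the one in `hL` is the derivative of the one in `hN`. Both
  -- vanish at `0`, so nonnegativity passes upwards.
  have hL : ∀ x ∈ Set.Ico (0 : ℝ) 1, 0 ≤ x * ((1 - q) * ((1 - x) ^ (q - 1 - 1) +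
      (1 + x) ^ (q - 1 - 1))) - ((1 - x) ^ (q - 1) - (1 + x) ^ (q - 1)) := by
    intro x hx
    have := le_of_hasDerivAt_nonneg' (f := fun x => x * ((1 - q) * ((1 - x) ^ (q - 1 - 1) +
      (1 + x) ^ (q - 1 - 1))) - ((1 - x) ^ (q - 1) - (1 + x) ^ (q - 1)))
      (f' := fun x => x * ((1 - q) * (2 - q) * ((1 - x) ^ (q - 1 - 1 - 1) -
      (1 + x) ^ (q - 1 - 1 - 1)))) hx.1 ?_ ?_
    · simpa using this
    · intro y hy
      have hy' : y ∈ Set.Ico (0 : ℝ) 1 := ⟨hy.1, hy.2.trans_lt hx.2⟩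
      refine (((hasDerivAt_id y).mul (((hdm (q - 1 - 1) y hy').add
        (hdp (q - 1 - 1) y hy')).const_mul (1 - q))).sub
        ((hdm (q - 1) y hy').sub (hdp (q - 1) y hy'))).congr_deriv ?_
      simp only [id, Pi.add_apply]
      ring
    · intro y hy
      have h1 : (1 + y) ^ (q - 1 - 1 - 1) ≤ (1 - y) ^ (q - 1 - 1 - 1) :=
        Real.rpow_le_rpow_of_nonpos (by linarith [hy.2, hx.2]) (by linarith [hy.1]) (by linarith)
      exact mul_nonneg hy.1.le (mul_nonneg (mul_nonneg (by linarith) (by linarith))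
        (by linarith))
  have hN : ∀ x ∈ Set.Ico (0 : ℝ) 1, 0 ≤ q * x * ((1 - x) ^ (q - 1) - (1 + x) ^ (q - 1)) -
      2 * (2 - ((1 + x) ^ q + (1 - x) ^ q)) := by
    intro x hx
    have := le_of_hasDerivAt_nonneg' (f := fun x => q * x * ((1 - x) ^ (q - 1) -
      (1 + x) ^ (q - 1)) - 2 * (2 - ((1 + x) ^ q + (1 - x) ^ q)))
      (f' := fun x => q * (x * ((1 - q) * ((1 - x) ^ (q - 1 - 1) +
      (1 + x) ^ (q - 1 - 1))) - ((1 - x) ^ (q - 1) - (1 + x) ^ (q - 1)))) hx.1 ?_ ?_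
    · refine le_trans (le_of_eq ?_) this
      norm_num
    · intro y hy
      have hy' : y ∈ Set.Ico (0 : ℝ) 1 := ⟨hy.1, hy.2.trans_lt hx.2⟩
      refine ((((hasDerivAt_id y).const_mul q).mul ((hdm (q - 1) y hy').sub
        (hdp (q - 1) y hy'))).sub ((((hdp q y hy').add (hdm q y hy')).const_sub 2).const_mul
        2)).congr_deriv ?_
      simp only [id, Pi.sub_apply]
      ring
    · intro y hy
      exact mul_nonneg hq.le (hL y ⟨hy.1.le, hy.2.trans hx.2⟩)
  have hc : ∀ x ∈ Set.Icc r 1, x ^ 2 ≠ 0 := fun x hx => by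
    have : 0 < x := hr.trans_le hx.1
    positivity
  -- The nondecreasing quotient `(2 - g x) / x^2` equals `2 - 2^q` at `1`. The endpoint `1`, where
  -- `(1 - x)^q` may fail to be differentiable, needs only continuity.
  have hR := le_of_hasDerivAt_nonneg (f := fun x => (2 - ((1 + x) ^ q + (1 - x) ^ q)) / x ^ 2)
    (f' := fun x => (q * x * ((1 - x) ^ (q - 1) - (1 + x) ^ (q - 1)) -
      2 * (2 - ((1 + x) ^ q + (1 - x) ^ q))) / x ^ 3) hr1 ?_ ?_ ?_
  · have h0 : (1 - 1 : ℝ) ^ q = 0 := by rw [sub_self, Real.zero_rpow hq.ne']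
    simp only [h0] at hR
    rw [div_le_iff₀ (by positivity)] at hR
    norm_num at hR
    linarith
  · refine ContinuousOn.div ?_ (by fun_prop) hc
    refine continuousOn_const.sub (ContinuousOn.add ?_ ?_)
    · exact ContinuousOn.rpow_const (by fun_prop) (fun _ _ => Or.inr hq.le)
    · exact ContinuousOn.rpow_const (by fun_prop) (fun _ _ => Or.inr hq.le)
  · intro y hy
    have hy0 : 0 < y := hr.trans hy.1
    have hy' : y ∈ Set.Ico (0 : ℝ) 1 := ⟨hy0.le, hy.2⟩
    refine ((((hdp q y hy').add (hdm q y hy')).const_sub 2).div (hasDerivAt_pow 2 y)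
      (by positivity)).congr_deriv ?_
    simp only [Pi.add_apply]
    field_simp
    push_cast
    ring
  · intro y hy
    have hy0 : 0 < y := hr.trans hy.1
    exact div_nonneg (hN y ⟨hy0.le, hy.2⟩) (by positivity)

theorem two_rpow_le_two {q : ℝ} (hq1 : q ≤ 1) : (2 : ℝ) ^ q ≤ 2 := by
  simpa using Real.rpow_le_rpow_of_exponent_le (by norm_num : (1 : ℝ) ≤ 2) hq1

theorem one_le_two_rpow {q : ℝ} (hq : 0 < q) : (1 : ℝ) ≤ 2 ^ q :=
  Real.one_le_rpow (by norm_num) hq.le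

theorem neg_mul_sq_le_abs_rpow_add {q r : ℝ} (hq : 0 < q) (hq1 : q ≤ 1) (hr : 0 ≤ r) :
    -(2 - 2 ^ q) * r ^ 2 ≤ |1 + r| ^ q + |1 - r| ^ q - 2 := by
  rw [abs_of_nonneg (by linarith : 0 ≤ 1 + r)]
  rcases le_total r 1 with h | h
  · rw [abs_of_nonneg (by linarith : 0 ≤ 1 - r)]
    linarith [chord_le_one_add_rpow_add_one_sub_rpow hq hq1 hr h]
  · have h1 : (2 : ℝ) ^ q ≤ (1 + r) ^ q := Real.rpow_le_rpow (by norm_num) (by linarith) hq.le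
    have h2 : 0 ≤ |1 - r| ^ q := by positivity
    have h3 := mul_nonneg (sub_nonneg.2 (two_rpow_le_two hq1)) (by nlinarith : 0 ≤ r ^ 2 - 1)
    linarith

/-- Here `1 + r ≥ 2` and `r - 1 ≥ 1/3`, so the right side is at least `1/3 - (2 - 2^q)`; then `2 -
2^q ≤ 1` is used. -/
theorem neg_two_thirds_le_abs_rpow_add {q r : ℝ} (hq : 0 < q) (hq1 : q ≤ 1) (hr : 4 / 3 ≤ r) :
    -(2 / 3 * (2 - 2 ^ q)) ≤ |1 + r| ^ q + |1 - r| ^ q - 2 := by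
  have h1 : (2 : ℝ) ^ q ≤ |1 + r| ^ q :=
    Real.rpow_le_rpow (by norm_num) ((by linarith : 2 ≤ 1 + r).trans (le_abs_self _)) hq.le
  have h2 : (1 / 3 : ℝ) ^ (1 : ℝ) ≤ (1 / 3 : ℝ) ^ q :=
    Real.rpow_le_rpow_of_exponent_ge (by norm_num) (by norm_num) hq1
  have h3 : (1 / 3 : ℝ) ^ q ≤ |1 - r| ^ q := by
    refine Real.rpow_le_rpow (by norm_num) ?_ hq.le
    rw [abs_sub_comm]
    exact (by linarith : 1 / 3 ≤ r - 1).trans (le_abs_self _)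
  rw [Real.rpow_one] at h2
  have := one_le_two_rpow hq
  linarith

/-- Concavity: `2` and `t` lie between `1` and `t + 1`, and the two pairs have the same sum. -/
theorem rpow_add_one_sub_le {q t : ℝ} (hq : 0 < q) (hq1 : q ≤ 1) (ht : 1 ≤ t) :
    (t + 1) ^ q + 1 ≤ t ^ q + 2 ^ q := by
  have hc := Real.concaveOn_rpow hq.le hq1
  have ht0 : 0 < t := by linarith
  have e : (t - 1) / t + 1 / t = 1 := by field_simp; ring
  have h1 := hc.2 (x := 1) (y := t + 1) (by simp) (by simp; linarith)
    (div_nonneg (by linarith) ht0.le : 0 ≤ (t - 1) / t) (by positivity : 0 ≤ 1 / t) e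
  have h2 := hc.2 (x := 1) (y := t + 1) (by simp) (by simp; linarith)
    (by positivity : 0 ≤ 1 / t) (div_nonneg (by linarith) ht0.le : 0 ≤ (t - 1) / t) (by linarith)
  simp only [smul_eq_mul, Real.one_rpow, mul_one] at h1 h2
  rw [show (t - 1) / t + 1 / t * (t + 1) = 2 by field_simp; ring] at h1
  rw [show 1 / t + (t - 1) / t * (t + 1) = t by field_simp; ring] at h2
  have : (t - 1) / t * (t + 1) ^ q + 1 / t * (t + 1) ^ q = (t + 1) ^ q := by
    rw [← add_mul, e, one_mul]
  linarith

/-- For `v ≥ 1` this is `rpow_add_one_sub_le`; for `0 < v ≤ 1`, apply it to `1/v`, multiply by `v^q`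
and use `v ≤ v^q`. For `v ≤ 0`, `|1 + v| ≤ max 1 |v|` leaves at least `(min 1 |v|)^q`, and `2 - 2^q
≤ 1`. -/
theorem mul_min_le_one_add_abs_rpow_sub {q : ℝ} (hq : 0 < q) (hq1 : q ≤ 1) (v : ℝ) :
    (2 - 2 ^ q) * min 1 |v| ≤ 1 + |v| ^ q - |1 + v| ^ q := by
  have hk0 : 0 ≤ 2 - (2 : ℝ) ^ q := by linarith [two_rpow_le_two hq1]
  have hk1 : 2 - (2 : ℝ) ^ q ≤ 1 := by linarith [one_le_two_rpow hq]
  have hself : ∀ w : ℝ, 0 ≤ w → w ≤ 1 → w ≤ w ^ q := fun w h0 h1 => by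
    simpa using Real.rpow_le_rpow_of_exponent_ge_of_imp h0 h1 hq1 (fun _ h => absurd h one_ne_zero)
  rcases le_total 0 v with hv | hv
  · rw [abs_of_nonneg hv, abs_of_nonneg (by linarith : 0 ≤ 1 + v)]
    rcases le_total 1 v with h1 | h1
    · rw [min_eq_left h1, add_comm 1 v]
      linarith [rpow_add_one_sub_le hq hq1 h1]
    · rw [min_eq_right h1]
      rcases hv.eq_or_lt with rfl | hv
      · simp [Real.zero_rpow hq.ne']
      · have h2 := rpow_add_one_sub_le hq hq1 ((one_le_inv₀ hv).2 h1)
        have h3 : (v⁻¹ + 1) ^ q * v ^ q = (1 + v) ^ q := by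
          rw [← Real.mul_rpow (by positivity) hv.le]; congr 1; field_simp
        have h4 : (v⁻¹) ^ q * v ^ q = 1 := by
          rw [← Real.mul_rpow (by positivity) hv.le, inv_mul_cancel₀ hv.ne', Real.one_rpow]
        have h5 := mul_le_mul_of_nonneg_right h2 (Real.rpow_nonneg hv.le q)
        have h6 := mul_le_mul_of_nonneg_left (hself v hv.le h1) hk0
        rw [add_mul, h3, add_mul, h4] at h5
        linarith
  · have hw : 0 ≤ |v| := abs_nonneg v
    have h1v : |1 + v| ≤ max 1 |v| := by
      rw [abs_of_nonpos hv, abs_le]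
      constructor
      · have := le_max_right 1 (-v); linarith
      · have := le_max_left 1 (-v); linarith
    have h2 : |1 + v| ^ q ≤ (max 1 |v|) ^ q := Real.rpow_le_rpow (abs_nonneg _) h1v hq.le
    rcases le_total 1 |v| with h1 | h1
    · rw [max_eq_right h1] at h2
      rw [min_eq_left h1]
      linarith
    · rw [max_eq_left h1, Real.one_rpow] at h2
      rw [min_eq_right h1]
      have := hself _ hw h1
      nlinarith

/-- A lower bound for a function vanishing to first order at `0` from a quadratic and a constant
lower bound for its second derivative. -/
theorem bounds_of_second_deriv_ge {f f' f'' : ℝ → ℝ} {K : ℝ} (hK : 0 ≤ K)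
    (hf : ∀ x, HasDerivAt f (f' x) x) (hf' : ∀ x, HasDerivAt f' (f'' x) x)
    (h0 : f 0 = 0) (h0' : f' 0 = 0) (h1 : ∀ x, 0 ≤ x → -K * x ^ 2 ≤ f'' x)
    (h2 : ∀ x, 4 / 3 ≤ x → -(2 / 3 * K) ≤ f'' x) {r : ℝ} (hr : 0 ≤ r) :
    -(K * r ^ 4 / 12) ≤ f r ∧ -(K * r ^ 2 / 3) ≤ f r := by
  have hA : ∀ x, 0 ≤ x → -(K * x ^ 3 / 3) ≤ f' x := by
    intro x hx
    have := le_of_hasDerivAt_nonneg' (f := fun x => f' x + K * x ^ 3 / 3)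
      (f' := fun x => f'' x + K * x ^ 2) hx
      (fun y _ => ((hf' y).add (((hasDerivAt_pow 3 y).const_mul K).div_const 3)).congr_deriv
        (by push_cast; ring))
      (fun y hy => by linarith [h1 y hy.1.le])
    norm_num [h0'] at this
    linarith
  -- The cubic bound `hA` implies the linear one while `x^2 ≤ 2`; since `(4/3)^2 < 2`, this reaches
  -- the range where `h2` takes over.
  have hB : ∀ x, 0 ≤ x → -(2 / 3 * K * x) ≤ f' x := by
    have hsmall : ∀ x, 0 ≤ x → x ≤ 4 / 3 → -(2 / 3 * K * x) ≤ f' x := by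
      intro x hx hx'
      have := mul_nonneg (mul_nonneg hK hx) (by nlinarith : 0 ≤ 2 - x ^ 2)
      linarith [hA x hx]
    intro x hx
    rcases le_total x (4 / 3) with h | h
    · exact hsmall x hx h
    · have := le_of_hasDerivAt_nonneg' (f := fun x => f' x + 2 / 3 * K * x)
        (f' := fun x => f'' x + 2 / 3 * K) h
        (fun y _ => ((hf' y).add ((hasDerivAt_id y).const_mul (2 / 3 * K))).congr_deriv
          (by ring))
        (fun y hy => by linarith [h2 y hy.1.le])
      have h3 := hsmall (4 / 3) (by norm_num) le_rfl
      linarith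
  constructor
  · have := le_of_hasDerivAt_nonneg' (f := fun x => f x + K * x ^ 4 / 12)
      (f' := fun x => f' x + K * x ^ 3 / 3) hr
      (fun y _ => ((hf y).add (((hasDerivAt_pow 4 y).const_mul K).div_const 12)).congr_deriv
        (by push_cast; ring))
      (fun y hy => by linarith [hA y hy.1.le])
    norm_num [h0] at this
    linarith
  · have := le_of_hasDerivAt_nonneg' (f := fun x => f x + K * x ^ 2 / 3)
      (f' := fun x => f' x + 2 / 3 * K * x) hr
      (fun y _ => ((hf y).add (((hasDerivAt_pow 2 y).const_mul K).div_const 3)).congr_deriv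
        (by push_cast; ring))
      (fun y hy => by linarith [hB y hy.1.le])
    norm_num [h0] at this
    linarith

/-- Two integrations give `f r ≥ K r^3 / 6` on `[0, 1]`. As a function of `s = r^2`, `s^(3/2) / 6`
is convex, and `a s / 4 - a^3 / 12` is its tangent at `s = a^2`. Being affine in `r^2`, the bound
can later be averaged knowing only a second moment. -/
theorem quadratic_le_of_second_deriv_ge {f f' f'' : ℝ → ℝ} {K a : ℝ} (hK : 0 ≤ K) (ha : 0 ≤ a)
    (ha1 : a ≤ 1) (hf : ∀ x, HasDerivAt f (f' x) x) (hf' : ∀ x, HasDerivAt f' (f'' x) x)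
    (h0 : f 0 = 0) (h0' : f' 0 = 0) (h1 : ∀ x, 0 ≤ x → K * min 1 x ≤ f'' x)
    {r : ℝ} (hr : 0 ≤ r) : K * (a * r ^ 2 / 4 - a ^ 3 / 12) ≤ f r := by
  have hA : ∀ x, 0 ≤ x → x ≤ a → K * x ^ 2 / 2 ≤ f' x := by
    intro x hx hxa
    have := le_of_hasDerivAt_nonneg' (f := fun x => f' x - K * x ^ 2 / 2)
      (f' := fun x => f'' x - K * x) hx
      (fun y _ => ((hf' y).sub (((hasDerivAt_pow 2 y).const_mul K).div_const 2)).congr_deriv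
        (by push_cast; ring))
      (fun y hy => by
        have := h1 y hy.1.le
        rw [min_eq_right (by linarith [hy.2])] at this
        linarith)
    norm_num [h0'] at this
    linarith
  have hB : ∀ x, 0 ≤ x → x ≤ a → K * x ^ 3 / 6 ≤ f x := by
    intro x hx hxa
    have := le_of_hasDerivAt_nonneg' (f := fun x => f x - K * x ^ 3 / 6)
      (f' := fun x => f' x - K * x ^ 2 / 2) hx
      (fun y _ => ((hf y).sub (((hasDerivAt_pow 3 y).const_mul K).div_const 6)).congr_deriv
        (by push_cast; ring))
      (fun y hy => by linarith [hA y hy.1.le (hy.2.le.trans hxa)])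
    norm_num [h0] at this
    linarith
  rcases le_total r a with h | h
  · have h2 : 0 ≤ (r - a) ^ 2 * (2 * r + a) := by positivity
    have h3 := mul_nonneg hK h2
    linarith [hB r hr h]
  · have hC : ∀ x, a ≤ x → K * (a * x - a ^ 2 / 2) ≤ f' x := by
      intro x hx
      have := le_of_hasDerivAt_nonneg' (f := fun x => f' x - K * (a * x - a ^ 2 / 2))
        (f' := fun x => f'' x - K * a) hx
        (fun y _ => ((hf' y).sub ((((hasDerivAt_id y).const_mul a).sub_const _).const_mul
          K)).congr_deriv (by ring))
        (fun y hy => by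
          have h3 := h1 y (ha.trans hy.1.le)
          have h4 := mul_le_mul_of_nonneg_left (le_min ha1 hy.1.le) hK
          linarith)
      have h5 := hA a ha le_rfl
      linarith
    have := le_of_hasDerivAt_nonneg' (f := fun x => f x - K * (a * x ^ 2 / 4 - a ^ 3 / 12))
      (f' := fun x => f' x - K * (a * x / 2)) h
      (fun y _ => ((hf y).sub (((((hasDerivAt_pow 2 y).const_mul a).div_const 4).sub_const
        _).const_mul K)).congr_deriv (by push_cast; ring))
      (fun y hy => by
        have h3 := hC y hy.1.le
        have h4 := mul_nonneg (mul_nonneg hK ha) (sub_nonneg.2 hy.1.le)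
        linarith)
    have h5 := hB a ha le_rfl
    linarith

/-! ### Second-order pointwise bounds for `|x + y|^p`. -/

theorem hasDerivAt_abs_affine_rpow {p : ℝ} (hp : 2 < p) (s x : ℝ) :
    HasDerivAt (fun x : ℝ => |1 + s * x| ^ p) (s * (p * (|1 + s * x| ^ (p - 2) * (1 + s * x)))) x := by
  have h := (hasDerivAt_abs_rpow (1 + s * x) (by linarith : 1 < p)).comp x
    (((hasDerivAt_id x).const_mul s).const_add 1)
  refine h.congr_deriv ?_
  ring

theorem hasDerivAt_abs_affine_rpow_mul_self {q : ℝ} (hq : 0 < q) (s x : ℝ) :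
    HasDerivAt (fun x : ℝ => |1 + s * x| ^ q * (1 + s * x)) (s * ((q + 1) * |1 + s * x| ^ q)) x := by
  have h := (hasDerivAt_abs_rpow_mul_self hq (1 + s * x)).comp x
    (((hasDerivAt_id x).const_mul s).const_add 1)
  refine h.congr_deriv ?_
  ring

theorem symm_abs_rpow_ge {p : ℝ} (hp : 2 < p) (hp3 : p ≤ 3) (r : ℝ) :
    -(p * (p - 1) * (2 - 2 ^ (p - 2)) * r ^ 4 / 12) ≤
      |1 + r| ^ p + |1 - r| ^ p - 2 - p * (p - 1) * r ^ 2 ∧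
    -(p * (p - 1) * (2 - 2 ^ (p - 2)) * r ^ 2 / 3) ≤
      |1 + r| ^ p + |1 - r| ^ p - 2 - p * (p - 1) * r ^ 2 := by
  wlog hr : 0 ≤ r generalizing r
  · have := this (-r) (by linarith)
    rw [sub_neg_eq_add, ← sub_eq_add_neg, neg_sq, Even.neg_pow (by decide : Even 4),
      add_comm (|1 - r| ^ p)] at this
    exact this
  have hq : 0 < p - 2 := by linarith
  have hq1 : p - 2 ≤ 1 := by linarith
  have hc : 0 ≤ p * (p - 1) := mul_nonneg (by linarith) (by linarith)
  refine bounds_of_second_deriv_ge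
    (f := fun r => |1 + r| ^ p + |1 - r| ^ p - 2 - p * (p - 1) * r ^ 2)
    (f' := fun r => p * (|1 + r| ^ (p - 2) * (1 + r)) - p * (|1 - r| ^ (p - 2) * (1 - r))
      - 2 * p * (p - 1) * r)
    (f'' := fun r => p * (p - 1) * (|1 + r| ^ (p - 2) + |1 - r| ^ (p - 2) - 2))
    (mul_nonneg hc (sub_nonneg.2 (two_rpow_le_two hq1))) ?_ ?_ ?_ ?_ ?_ ?_ hr
  · intro x
    have h1 := hasDerivAt_abs_affine_rpow hp 1 x
    have h2 := hasDerivAt_abs_affine_rpow hp (-1) x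
    simp only [one_mul, neg_one_mul, ← sub_eq_add_neg] at h1 h2
    exact (((h1.add h2).sub_const 2).sub ((hasDerivAt_pow 2 x).const_mul _)).congr_deriv
      (by push_cast; ring)
  · intro x
    have h1 := hasDerivAt_abs_affine_rpow_mul_self hq 1 x
    have h2 := hasDerivAt_abs_affine_rpow_mul_self hq (-1) x
    simp only [one_mul, neg_one_mul, ← sub_eq_add_neg] at h1 h2
    exact (((h1.const_mul p).sub (h2.const_mul p)).sub ((hasDerivAt_id x).const_mul
      (2 * p * (p - 1)))).congr_deriv (by ring)
  · norm_num
  · norm_num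
  · intro x hx
    have := mul_le_mul_of_nonneg_left (neg_mul_sq_le_abs_rpow_add hq hq1 hx) hc
    linarith
  · intro x hx
    have := mul_le_mul_of_nonneg_left (neg_two_thirds_le_abs_rpow_add hq hq1 hx) hc
    linarith

theorem one_add_abs_rpow_sub_ge {p a : ℝ} (hp : 2 < p) (hp3 : p ≤ 3) (ha : 0 ≤ a) (ha1 : a ≤ 1)
    (v : ℝ) : p * (p - 1) * (2 - 2 ^ (p - 2)) * (a * v ^ 2 / 4 - a ^ 3 / 12) ≤
      1 + p * v + p * (p - 1) / 2 * v ^ 2 + |v| ^ p - |1 + v| ^ p := by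
  have hq : 0 < p - 2 := by linarith
  have hq1 : p - 2 ≤ 1 := by linarith
  have hc : 0 ≤ p * (p - 1) := mul_nonneg (by linarith) (by linarith)
  -- The sign `s` treats the half-lines `v ≥ 0` and `v ≤ 0` together.
  have key : ∀ s : ℝ, |s| = 1 → ∀ r : ℝ, 0 ≤ r →
      p * (p - 1) * (2 - 2 ^ (p - 2)) * (a * r ^ 2 / 4 - a ^ 3 / 12) ≤
      1 + p * (s * r) + p * (p - 1) / 2 * r ^ 2 + |r| ^ p - |1 + s * r| ^ p := by
    intro s hs r hr
    have hs2 : s * s = 1 := by rw [← abs_mul_abs_self, hs, one_mul]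
    refine quadratic_le_of_second_deriv_ge
      (f := fun r => 1 + p * (s * r) + p * (p - 1) / 2 * r ^ 2 + |r| ^ p - |1 + s * r| ^ p)
      (f' := fun r => p * s + p * (p - 1) * r + p * (|r| ^ (p - 2) * r)
        - s * (p * (|1 + s * r| ^ (p - 2) * (1 + s * r))))
      (f'' := fun r => p * (p - 1) * (1 + |r| ^ (p - 2) - |1 + s * r| ^ (p - 2)))
      (mul_nonneg hc (sub_nonneg.2 (two_rpow_le_two hq1))) ha ha1 ?_ ?_ ?_ ?_ ?_ hr
    · intro x
      exact ((((((hasDerivAt_id x).const_mul s).const_mul p).const_add 1).add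
        ((hasDerivAt_pow 2 x).const_mul (p * (p - 1) / 2))).add
        (hasDerivAt_abs_rpow x (by linarith : 1 < p))).sub
        (hasDerivAt_abs_affine_rpow hp s x) |>.congr_deriv (by push_cast; ring)
    · intro x
      refine (((((hasDerivAt_id x).const_mul (p * (p - 1))).const_add (p * s)).add
        ((hasDerivAt_abs_rpow_mul_self hq x).const_mul p)).sub
        (((hasDerivAt_abs_affine_rpow_mul_self hq s x).const_mul p).const_mul s)).congr_deriv ?_
      linear_combination (-(p * (p - 1) * |1 + s * x| ^ (p - 2))) * hs2
    · norm_num [Real.zero_rpow (by linarith : p ≠ 0)]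
    · norm_num
      ring
    · intro x hx
      have h1 := mul_le_mul_of_nonneg_left (mul_min_le_one_add_abs_rpow_sub hq hq1 (s * x)) hc
      rw [abs_mul, hs, one_mul] at h1
      nth_rewrite 1 [abs_of_nonneg hx] at h1
      linarith
  rcases le_total 0 v with hv | hv
  · simpa using key 1 (by simp) v hv
  · simpa using key (-1) (by simp) (-v) (by linarith)

theorem abs_add_rpow_le_of_pos {p a x : ℝ} (hp : 2 < p) (hp3 : p ≤ 3) (ha : 0 ≤ a) (ha1 : a ≤ 1)
    (hx : 0 < x) (y : ℝ) : |x + y| ^ p ≤ x ^ p + p * x ^ (p - 1) * y +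
      p * (p - 1) / 2 * x ^ (p - 2) * y ^ 2 + |y| ^ p -
      p * (p - 1) * (2 - 2 ^ (p - 2)) * x ^ p * (a * (y / x) ^ 2 / 4 - a ^ 3 / 12) := by
  have h := mul_le_mul_of_nonneg_left (one_add_abs_rpow_sub_ge hp hp3 ha ha1 (y / x))
    (Real.rpow_nonneg hx.le p)
  have e1 : x ^ (p - 1) = x ^ p / x := by rw [Real.rpow_sub hx, Real.rpow_one]
  have e2 : x ^ (p - 2) = x ^ p / x ^ 2 := by rw [Real.rpow_sub hx, Real.rpow_two]
  have e3 : x ^ p * |y / x| ^ p = |y| ^ p := by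
    rw [← Real.mul_rpow hx.le (abs_nonneg _), abs_div, abs_of_pos hx,
      mul_div_cancel₀ _ hx.ne']
  have e4 : x ^ p * |1 + y / x| ^ p = |x + y| ^ p := by
    rw [← Real.mul_rpow hx.le (abs_nonneg _)]
    congr 1
    rw [show x + y = x * (1 + y / x) by field_simp, abs_mul, abs_of_pos hx]
  have e5 : x ^ p / x * y = x ^ p * (y / x) := by ring
  have e6 : x ^ p / x ^ 2 * y ^ 2 = x ^ p * (y / x) ^ 2 := by ring
  rw [e1, e2]
  linear_combination h + e3 - e4 + p * e5 + p * (p - 1) / 2 * e6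

theorem symm_abs_add_rpow_ge_of_pos {p x : ℝ} (hp : 2 < p) (hp3 : p ≤ 3) (hx : 0 < x) (z : ℝ) :
    2 * x ^ p + p * (p - 1) * x ^ (p - 2) * z ^ 2 -
      p * (p - 1) * (2 - 2 ^ (p - 2)) * x ^ p * ((z / x) ^ 4 / 12) ≤ |x + z| ^ p + |x - z| ^ p ∧
    2 * x ^ p + p * (p - 1) * x ^ (p - 2) * z ^ 2 -
      p * (p - 1) * (2 - 2 ^ (p - 2)) * x ^ p * ((z / x) ^ 2 / 3) ≤ |x + z| ^ p + |x - z| ^ p := by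
  have h1 := mul_le_mul_of_nonneg_left (symm_abs_rpow_ge hp hp3 (z / x)).1
    (Real.rpow_nonneg hx.le p)
  have h2 := mul_le_mul_of_nonneg_left (symm_abs_rpow_ge hp hp3 (z / x)).2
    (Real.rpow_nonneg hx.le p)
  have e2 : x ^ (p - 2) = x ^ p / x ^ 2 := by rw [Real.rpow_sub hx, Real.rpow_two]
  have e4 : ∀ y, x ^ p * |1 + y / x| ^ p = |x + y| ^ p := fun y => by
    rw [← Real.mul_rpow hx.le (abs_nonneg _)]
    congr 1
    rw [show x + y = x * (1 + y / x) by field_simp, abs_mul, abs_of_pos hx]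
  have e5 := e4 z
  have e6 := e4 (-z)
  rw [neg_div, ← sub_eq_add_neg, ← sub_eq_add_neg] at e6
  have e7 : x ^ p / x ^ 2 * z ^ 2 = x ^ p * (z / x) ^ 2 := by ring
  rw [e2]
  constructor
  · linear_combination h1 + e5 + e6 + p * (p - 1) * e7
  · linear_combination h2 + e5 + e6 + p * (p - 1) * e7

/-! ### Convolutions, integrability and Gaussian moments. -/

theorem memLp_id_conv {μ ν : Measure ℝ} [IsProbabilityMeasure μ] [IsProbabilityMeasure ν]
    {p : ENNReal} (hμ : MemLp id p μ) (hν : MemLp id p ν) : MemLp id p (μ.conv ν) := by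
  rw [Measure.conv, memLp_map_measure_iff (by fun_prop) (by fun_prop)]
  exact (hμ.comp_fst ν).add (hν.comp_snd μ)

theorem integral_conv_eq {μ ν : Measure ℝ} [IsProbabilityMeasure μ] [IsProbabilityMeasure ν]
    {f : ℝ → ℝ} (hf : Integrable f (μ.conv ν)) :
    ∫ w, f w ∂(μ.conv ν) = ∫ x, ∫ y, f (x + y) ∂ν ∂μ := by
  rw [Measure.conv] at hf ⊢
  rw [integral_map (by fun_prop) hf.1, integral_prod]
  exact hf.comp_measurable (by fun_prop)

theorem MemLp.integrable_abs_rpow {Ω : Type*} [MeasurableSpace Ω] {μ : Measure Ω} {p : ℝ}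
    (hp : 0 < p) {f : Ω → ℝ} (hf : MemLp f (ENNReal.ofReal p) μ) :
    Integrable (fun x => |f x| ^ p) μ := by
  have := hf.integrable_norm_rpow (by simpa using hp) (by simp)
  simpa [ENNReal.toReal_ofReal hp.le] using this

theorem MemLp.integrable_sq_of_two_lt {Ω : Type*} [MeasurableSpace Ω] {μ : Measure Ω}
    [IsFiniteMeasure μ] {p : ℝ}
    (hp : 2 < p) {f : Ω → ℝ} (hf : MemLp f (ENNReal.ofReal p) μ) :
    Integrable (fun x => f x ^ 2) μ := by
  refine (hf.mono_exponent ?_).integrable_sq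
  rw [show (2 : ENNReal) = ENNReal.ofReal 2 by simp]
  exact ENNReal.ofReal_le_ofReal hp.le

theorem MemLp.integrable_of_two_lt {Ω : Type*} [MeasurableSpace Ω] {μ : Measure Ω}
    [IsFiniteMeasure μ] {p : ℝ}
    (hp : 2 < p) {f : Ω → ℝ} (hf : MemLp f (ENNReal.ofReal p) μ) : Integrable f μ := by
  refine hf.integrable ?_
  rw [show (1 : ENNReal) = ENNReal.ofReal 1 by simp]
  exact ENNReal.ofReal_le_ofReal (by linarith)

theorem MemLp.integrable_abs_const_add_rpow {μ : Measure ℝ} [IsFiniteMeasure μ] {p : ℝ}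
    (hp : 0 < p) (hμ : MemLp id (ENNReal.ofReal p) μ) (x : ℝ) :
    Integrable (fun y => |x + y| ^ p) μ :=
  MemLp.integrable_abs_rpow hp ((memLp_const x).add hμ)

theorem memLp_id_gaussianReal_ofReal (m : ℝ) (v : NNReal) (p : ℝ) :
    MemLp id (ENNReal.ofReal p) (gaussianReal m v) :=
  memLp_id_gaussianReal' _ (by simp)

theorem integrable_pow_gaussianReal (m : ℝ) (v : NNReal) (n : ℕ) :
    Integrable (fun x => x ^ n) (gaussianReal m v) := by
  have h := (memLp_id_gaussianReal' (μ := m) (v := v) n (by simp)).integrable_norm_pow'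
  refine h.mono' (by fun_prop) (Filter.Eventually.of_forall fun x => by simp)

theorem integral_sq_gaussianReal (v : NNReal) : ∫ x, x ^ 2 ∂gaussianReal 0 v = v := by
  have h := variance_fun_id_gaussianReal (μ := 0) (v := v)
  rw [variance_eq_integral (by fun_prop)] at h
  simpa using h

theorem integral_comp_neg_gaussianReal (v : NNReal) (f : ℝ → ℝ) :
    ∫ x, f (-x) ∂gaussianReal 0 v = ∫ x, f x ∂gaussianReal 0 v := by
  have h := gaussianReal_map_neg (μ := 0) (v := v)
  rw [neg_zero] at h
  conv_rhs => rw [← h]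
  exact ((MeasurableEquiv.neg ℝ).measurableEmbedding.integral_map f).symm

theorem integral_pow_three_gaussianReal (v : NNReal) : ∫ x, x ^ 3 ∂gaussianReal 0 v = 0 := by
  have h := integral_comp_neg_gaussianReal v (fun x => x ^ 3)
  simp only [Odd.neg_pow (by decide : Odd 3)] at h
  rw [integral_neg] at h
  linarith

/-- The fourth moment of variance `2v` is computed twice: scaling by `√2` gives `4M`, and a sum of
two independent copies gives `2M + 6v^2`. -/
theorem integral_pow_four_gaussianReal (v : NNReal) :
    ∫ x, x ^ 4 ∂gaussianReal 0 v = 3 * (v : ℝ) ^ 2 := by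
  set M := ∫ x, x ^ 4 ∂gaussianReal 0 v with hM
  have hconv : (gaussianReal 0 v).conv (gaussianReal 0 v) = gaussianReal 0 (v + v) := by
    simpa using gaussianReal_conv_gaussianReal (m₁ := 0) (m₂ := 0) (v₁ := v) (v₂ := v)
  have h1 : ∫ x, x ^ 4 ∂gaussianReal 0 (v + v) = 4 * M := by
    have h := gaussianReal_map_const_mul (μ := 0) (v := v) (√2)
    have e : (NNReal.mk (√2 ^ 2) (sq_nonneg _)) * v = v + v := by
      ext; simp; ring
    rw [mul_zero, e] at h
    rw [← h, integral_map (by fun_prop) (by fun_prop), hM, ← integral_const_mul]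
    congr 1 with x
    rw [mul_pow, show (√2) ^ 4 = ((√2) ^ 2) ^ 2 by ring, Real.sq_sqrt (by norm_num)]
    norm_num
  have h2 : ∫ x, x ^ 4 ∂gaussianReal 0 (v + v) = 2 * M + 6 * (v : ℝ) ^ 2 := by
    rw [← hconv, integral_conv_eq (by rw [hconv]; exact integrable_pow_gaussianReal _ _ _)]
    have i1 := integrable_pow_gaussianReal 0 v 1
    have i2 := integrable_pow_gaussianReal 0 v 2
    have i3 := integrable_pow_gaussianReal 0 v 3
    have i4 := integrable_pow_gaussianReal 0 v 4
    have hin : ∀ x : ℝ, ∫ y, (x + y) ^ 4 ∂gaussianReal 0 v = x ^ 4 + 6 * x ^ 2 * v + M := by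
      intro x
      have e : (fun y : ℝ => (x + y) ^ 4) = fun y => x ^ 4 + 4 * x ^ 3 * y ^ 1 + 6 * x ^ 2 * y ^ 2 +
          4 * x * y ^ 3 + y ^ 4 := by ext; ring
      rw [e, integral_add (by fun_prop) i4, integral_add (by fun_prop) (by fun_prop),
        integral_add (by fun_prop) (by fun_prop), integral_add (by fun_prop) (by fun_prop)]
      simp only [integral_const_mul]
      simp only [pow_one, integral_id_gaussianReal, integral_sq_gaussianReal,
        integral_pow_three_gaussianReal, integral_const]
      simp [hM]
    simp only [hin]
    rw [integral_add (by fun_prop) (by fun_prop), integral_add i4 (by fun_prop)]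
    simp only [integral_mul_const, integral_const_mul, integral_sq_gaussianReal, integral_const]
    simp only [probReal_univ, smul_eq_mul, ← hM]
    ring
  linarith

/-! ### Gaussian comparison and replacement of summands. -/

/-- For `2 < p ≤ 3`, a centered `Y` and a centered Gaussian `G` of the same variance satisfy
`E |x + Y| ^ p ≤ E |Y| ^ p + E |x + G| ^ p`. -/
theorem integral_abs_const_add_rpow_le {ν : Measure ℝ} [IsProbabilityMeasure ν] {p : ℝ}
    (hp : 2 < p) (hp3 : p ≤ 3) (hν : MemLp id (ENNReal.ofReal p) ν) (hm : ∫ y, y ∂ν = 0)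
    {v : NNReal} (hv : ∫ y, y ^ 2 ∂ν = v) (x : ℝ) :
    ∫ y, |x + y| ^ p ∂ν ≤ ∫ y, |y| ^ p ∂ν + ∫ z, |x + z| ^ p ∂gaussianReal 0 v := by
  have hp0 : 0 < p := by linarith
  have hc : 0 ≤ p * (p - 1) := mul_nonneg hp0.le (by linarith)
  have hκ : 0 ≤ 2 - (2 : ℝ) ^ (p - 2) := sub_nonneg.2 (two_rpow_le_two (by linarith))
  -- Reflecting `Y` changes the sign of `x`, and the Gaussian is symmetric.
  wlog hx : 0 ≤ x generalizing x ν with key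
  · have hmeas : Measurable fun y : ℝ => -y := measurable_neg
    have hint : ∀ f : ℝ → ℝ, ∫ y, f y ∂(ν.map fun y => -y) = ∫ y, f (-y) ∂ν := fun f =>
      (MeasurableEquiv.neg ℝ).measurableEmbedding.integral_map f
    have : IsProbabilityMeasure (ν.map fun y => -y) :=
      Measure.isProbabilityMeasure_map hmeas.aemeasurable
    have h := key (ν := ν.map fun y => -y) ?_ ?_ ?_ (-x) (by linarith)
    · rw [hint, hint, ← integral_comp_neg_gaussianReal] at h
      simp only [← neg_add, abs_neg] at h
      exact h
    · rw [memLp_map_measure_iff (by fun_prop) (by fun_prop)]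
      exact hν.neg
    · rw [hint, integral_neg, hm, neg_zero]
    · rw [hint]; simpa using hv
  rcases hx.eq_or_lt with rfl | hx
  · simp only [zero_add]
    exact le_add_of_nonneg_right (integral_nonneg fun z => by positivity)
  have i1 : Integrable (fun y : ℝ => y ^ 1) ν := by
    have h : Integrable (fun y : ℝ => y) ν := MemLp.integrable_of_two_lt hp hν
    simpa only [pow_one] using h
  have i2 : Integrable (fun y : ℝ => y ^ 2) ν := MemLp.integrable_sq_of_two_lt hp hν
  have ip : Integrable (fun y : ℝ => |y| ^ p) ν := MemLp.integrable_abs_rpow hp0 hν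
  have ig : Integrable (fun z : ℝ => |x + z| ^ p) (gaussianReal 0 v) :=
    MemLp.integrable_abs_const_add_rpow hp0 (memLp_id_gaussianReal_ofReal 0 v p) x
  have ig' : Integrable (fun z : ℝ => |x - z| ^ p) (gaussianReal 0 v) :=
    MemLp.integrable_abs_rpow hp0 ((memLp_const x).sub (memLp_id_gaussianReal_ofReal 0 v p))
  have j2 := integrable_pow_gaussianReal 0 v 2
  have j4 := integrable_pow_gaussianReal 0 v 4
  have hsymm : ∫ z, |x - z| ^ p ∂gaussianReal 0 v = ∫ z, |x + z| ^ p ∂gaussianReal 0 v := by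
    rw [← integral_comp_neg_gaussianReal]
    simp
  set K := p * (p - 1) * (2 - 2 ^ (p - 2)) * x ^ p with hK
  have hK0 : 0 ≤ K := by positivity
  set c := p * (p - 1)
  set G := ∫ z, |x + z| ^ p ∂gaussianReal 0 v
  have upper : ∀ a, 0 ≤ a → a ≤ 1 → ∫ y, |x + y| ^ p ∂ν ≤ x ^ p + c / 2 * x ^ (p - 2) * v +
      ∫ y, |y| ^ p ∂ν - K * (a * (v / x ^ 2) / 4 - a ^ 3 / 12) := by
    intro a ha ha1
    have h := integral_mono (MemLp.integrable_abs_const_add_rpow hp0 hν x)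
      (g := fun y : ℝ => (x ^ p + K * (a ^ 3 / 12)) + p * x ^ (p - 1) * y ^ 1 +
        (c / 2 * x ^ (p - 2) - K * (a / x ^ 2 / 4)) * y ^ 2 + |y| ^ p) (by fun_prop) (fun y => by
          have := abs_add_rpow_le_of_pos hp hp3 ha ha1 hx y
          refine this.trans (le_of_eq ?_)
          simp only [hK, c]
          ring)
    rw [integral_add (by fun_prop) ip, integral_add (by fun_prop) (by fun_prop),
      integral_add (by fun_prop) (by fun_prop)] at h
    simp only [integral_const_mul] at h
    simp only [pow_one, hm, hv, integral_const, probReal_univ, one_smul] at h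
    refine h.trans (le_of_eq ?_)
    ring
  have lower1 : 2 * x ^ p + c * x ^ (p - 2) * v - K * (3 * (v / x ^ 2) ^ 2 / 12) ≤ 2 * G := by
    have h := integral_mono (f := fun z => 2 * x ^ p + c * x ^ (p - 2) * z ^ 2 -
      K / x ^ 4 / 12 * z ^ 4) (by fun_prop) (ig.add ig') (fun z => by
        refine (le_of_eq ?_).trans (symm_abs_add_rpow_ge_of_pos hp hp3 hx z).1
        simp only [hK, c]
        ring)
    simp only [Pi.add_apply] at h
    rw [integral_sub (by fun_prop) (by fun_prop), integral_add (by fun_prop) (by fun_prop),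
      integral_add ig ig', hsymm] at h
    simp only [integral_const_mul, integral_sq_gaussianReal, integral_pow_four_gaussianReal,
      integral_const, probReal_univ, one_smul] at h
    refine (le_of_eq ?_).trans (h.trans (le_of_eq ?_))
    · ring
    · ring
  have lower2 : 2 * x ^ p + c * x ^ (p - 2) * v - K * ((v / x ^ 2) / 3) ≤ 2 * G := by
    have h := integral_mono (f := fun z => 2 * x ^ p + c * x ^ (p - 2) * z ^ 2 -
      K / x ^ 2 / 3 * z ^ 2) (by fun_prop) (ig.add ig') (fun z => by
        refine (le_of_eq ?_).trans (symm_abs_add_rpow_ge_of_pos hp hp3 hx z).2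
        simp only [hK, c]
        ring)
    simp only [Pi.add_apply] at h
    rw [integral_sub (by fun_prop) (by fun_prop), integral_add (by fun_prop) (by fun_prop),
      integral_add ig ig', hsymm] at h
    simp only [integral_const_mul, integral_sq_gaussianReal,
      integral_const, probReal_univ, one_smul] at h
    refine (le_of_eq ?_).trans (h.trans (le_of_eq ?_))
    · ring
    · ring
  set t := (v : ℝ) / x ^ 2 with ht
  have ht0 : 0 ≤ t := by positivity
  -- The best tangent is at the mean `t` of `(Y/x)^2`, so `a = √t`, unless the constraint `a ≤ 1`
  -- forces `a = 1`. The cases reduce to `t^2 / 8 ≤ t^(3/2) / 6` and `t / 6 ≤ t / 4 - 1 / 12`.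
  rcases le_total t 1 with h1 | h1
  · have h := upper (√t) (Real.sqrt_nonneg t) (Real.sqrt_le_one.2 h1)
    have hs := Real.sq_sqrt ht0
    have hs0 := Real.sqrt_nonneg t
    have hs1 : √t ≤ 1 := Real.sqrt_le_one.2 h1
    have key : 3 * t ^ 2 / 24 ≤ √t * t / 4 - √t ^ 3 / 12 := by
      rw [← hs]
      have : √t ^ 3 * √t ≤ √t ^ 3 * 1 := mul_le_mul_of_nonneg_left hs1 (by positivity)
      have h3 : 0 ≤ √t ^ 3 := by positivity
      rw [hs]
      nlinarith
    have := mul_le_mul_of_nonneg_left key hK0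
    linarith
  · have h := upper 1 zero_le_one le_rfl
    have := mul_nonneg hK0 (sub_nonneg.2 h1)
    linarith

theorem integral_abs_rpow_conv_le {μ ν : Measure ℝ} [IsProbabilityMeasure μ]
    [IsProbabilityMeasure ν] {p : ℝ} (hp : 2 < p) (hp3 : p ≤ 3)
    (hμ : MemLp id (ENNReal.ofReal p) μ) (hν : MemLp id (ENNReal.ofReal p) ν)
    (hm : ∫ y, y ∂ν = 0) {v : NNReal} (hv : ∫ y, y ^ 2 ∂ν = v) :
    ∫ w, |w| ^ p ∂(μ.conv ν) ≤
      ∫ y, |y| ^ p ∂ν + ∫ w, |w| ^ p ∂(μ.conv (gaussianReal 0 v)) := by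
  have hp0 : 0 < p := by linarith
  have i1 : Integrable (fun w : ℝ => |w| ^ p) (μ.conv ν) :=
    MemLp.integrable_abs_rpow hp0 (memLp_id_conv hμ hν)
  have i2 : Integrable (fun w : ℝ => |w| ^ p) (μ.conv (gaussianReal 0 v)) :=
    MemLp.integrable_abs_rpow hp0 (memLp_id_conv hμ (memLp_id_gaussianReal_ofReal 0 v p))
  rw [integral_conv_eq i1, integral_conv_eq i2]
  have j1 : Integrable (fun x => ∫ y, |x + y| ^ p ∂ν) μ :=
    (i1.comp_measurable (f := fun z : ℝ × ℝ => z.1 + z.2) (by fun_prop)).integral_prod_left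
  have j2 : Integrable (fun x => ∫ y, |x + y| ^ p ∂gaussianReal 0 v) μ :=
    (i2.comp_measurable (f := fun z : ℝ × ℝ => z.1 + z.2) (by fun_prop)).integral_prod_left
  have h := integral_mono j1 ((integrable_const (∫ y, |y| ^ p ∂ν)).add j2)
    (fun x => integral_abs_const_add_rpow_le hp hp3 hν hm hv x)
  simp only [Pi.add_apply] at h
  rw [integral_add (by fun_prop) j2] at h
  simpa using h

theorem convexOn_abs_rpow {p : ℝ} (hp : 1 ≤ p) : ConvexOn ℝ Set.univ fun w : ℝ => |w| ^ p := by
  refine ⟨convex_univ, fun x _ y _ a b ha hb hab => ?_⟩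
  refine le_trans ?_ ((convexOn_rpow hp).2 (abs_nonneg x) (abs_nonneg y) ha hb hab)
  refine Real.rpow_le_rpow (abs_nonneg _) ?_ (by linarith)
  refine (abs_add_le _ _).trans (le_of_eq ?_)
  simp [abs_mul, abs_of_nonneg ha, abs_of_nonneg hb]

/-- Jensen's inequality in the centered variable, for each fixed value of the other one. -/
theorem integral_abs_rpow_le_conv {μ ν : Measure ℝ} [IsProbabilityMeasure μ]
    [IsProbabilityMeasure ν] {p : ℝ} (hp : 2 < p)
    (hμ : MemLp id (ENNReal.ofReal p) μ) (hν : MemLp id (ENNReal.ofReal p) ν)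
    (hm : ∫ y, y ∂ν = 0) : ∫ w, |w| ^ p ∂μ ≤ ∫ w, |w| ^ p ∂(μ.conv ν) := by
  have hp0 : 0 < p := by linarith
  have i1 : Integrable (fun w : ℝ => |w| ^ p) (μ.conv ν) :=
    MemLp.integrable_abs_rpow hp0 (memLp_id_conv hμ hν)
  rw [integral_conv_eq i1]
  have j1 : Integrable (fun x => ∫ y, |x + y| ^ p ∂ν) μ :=
    (i1.comp_measurable (f := fun z : ℝ × ℝ => z.1 + z.2) (by fun_prop)).integral_prod_left
  have k1 : Integrable (fun y : ℝ => y) ν := MemLp.integrable_of_two_lt hp hν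
  refine integral_mono (MemLp.integrable_abs_rpow hp0 hμ) j1 fun x => ?_
  have hj := (convexOn_abs_rpow (by linarith : 1 ≤ p)).map_integral_le (μ := ν) (f := fun y => x + y)
    (continuous_abs.rpow_const fun _ => Or.inr hp0.le).continuousOn isClosed_univ (by simp)
    ((integrable_const x).add k1) (MemLp.integrable_abs_const_add_rpow hp0 hν x)
  rw [integral_add (by fun_prop) k1, hm] at hj
  simpa using hj

theorem ae_measurable_of_memLp {Ω : Type*} [MeasurableSpace Ω] {P : Measure Ω} {p : ENNReal}
    {f : Ω → ℝ} (hf : MemLp f p P) : AEMeasurable f P :=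
  hf.aestronglyMeasurable.aemeasurable

theorem map_sum_insert {Ω : Type*} [MeasurableSpace Ω] {P : Measure Ω} [IsProbabilityMeasure P]
    {ι : Type*} [DecidableEq ι] {Y : ι → Ω → ℝ} (hY : ∀ i, AEMeasurable (Y i) P)
    (hind : iIndepFun Y P) {s : Finset ι} {i : ι} (hi : i ∉ s) :
    P.map (∑ j ∈ insert i s, Y j) = (P.map (∑ j ∈ s, Y j)).conv (P.map (Y i)) := by
  rw [Finset.sum_insert hi, add_comm]
  exact (hind.indepFun_finsetSum_of_notMem₀ hY hi).map_add_eq_map_conv_map₀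
    (Finset.aemeasurable_sum s fun j _ => hY j) (hY i)

theorem map_sum_empty {Ω : Type*} [MeasurableSpace Ω] {P : Measure Ω} [IsProbabilityMeasure P]
    {ι : Type*} {Y : ι → Ω → ℝ} : P.map (∑ j ∈ (∅ : Finset ι), Y j) = Measure.dirac 0 := by
  rw [Finset.sum_empty]
  change P.map (fun _ => (0 : ℝ)) = _
  simp

theorem gaussianReal_zero_conv (v w : NNReal) :
    (gaussianReal 0 v).conv (gaussianReal 0 w) = gaussianReal 0 (v + w) := by
  simpa using gaussianReal_conv_gaussianReal (m₁ := 0) (m₂ := 0) (v₁ := v) (v₂ := w)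

/-- Lindeberg replacement. The base law `μ` is arbitrary so that each new Gaussian can be absorbed
into it before the induction hypothesis is applied. -/
theorem integral_abs_rpow_conv_map_sum_le {Ω : Type*} [MeasurableSpace Ω] {P : Measure Ω}
    [IsProbabilityMeasure P] {p : ℝ} (hp : 2 < p) (hp3 : p ≤ 3) {n : ℕ} {Y : Fin n → Ω → ℝ}
    (hY : IsCenteredIndepSeq P p Y) {v : Fin n → NNReal} (hv : ∀ i, ∫ ω, Y i ω ^ 2 ∂P = v i)
    (s : Finset (Fin n)) (μ : Measure ℝ) [IsProbabilityMeasure μ]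
    (hμ : MemLp id (ENNReal.ofReal p) μ) :
    ∫ w, |w| ^ p ∂(μ.conv (P.map (∑ i ∈ s, Y i))) ≤ ∑ i ∈ s, ∫ ω, |Y i ω| ^ p ∂P +
      ∫ w, |w| ^ p ∂(μ.conv (gaussianReal 0 (∑ i ∈ s, v i))) := by
  have hm : ∀ i, AEMeasurable (Y i) P := fun i => ae_measurable_of_memLp (hY.memLp i)
  induction s using Finset.induction_on generalizing μ with
  | empty => rw [map_sum_empty]; simp
  | insert i s hi ih =>
    have : IsProbabilityMeasure (P.map (Y i)) := Measure.isProbabilityMeasure_map (hm i)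
    have : IsProbabilityMeasure (P.map (∑ j ∈ s, Y j)) :=
      Measure.isProbabilityMeasure_map (Finset.aemeasurable_sum s fun j _ => hm j)
    have hs : MemLp id (ENNReal.ofReal p) (P.map (∑ j ∈ s, Y j)) := by
      rw [memLp_map_measure_iff (by fun_prop) (Finset.aemeasurable_sum s fun j _ => hm j)]
      exact memLp_finsetSum' s fun j _ => hY.memLp j
    have hi' : MemLp id (ENNReal.ofReal p) (P.map (Y i)) := by
      rw [memLp_map_measure_iff (by fun_prop) (hm i)]
      exact hY.memLp i
    have hrp : Continuous fun w : ℝ => |w| ^ p :=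
      continuous_abs.rpow_const fun _ => Or.inr (by linarith)
    have h1 := integral_abs_rpow_conv_le hp hp3 (memLp_id_conv hμ hs) hi' (v := v i)
      (by rw [integral_map (hm i) (by fun_prop)]; exact hY.mean_zero i)
      (by rw [integral_map (hm i) (by fun_prop)]; exact hv i)
    have h2 := ih (μ.conv (gaussianReal 0 (v i)))
      (memLp_id_conv hμ (memLp_id_gaussianReal_ofReal 0 (v i) p))
    rw [integral_map (hm i) hrp.aestronglyMeasurable, Measure.conv_assoc, Measure.conv_assoc,
      Measure.conv_comm _ (gaussianReal 0 (v i))] at h1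
    rw [Measure.conv_assoc, Measure.conv_assoc μ _ (gaussianReal 0 _),
      gaussianReal_zero_conv] at h2
    rw [map_sum_insert hm hY.indep hi, Finset.sum_insert hi, Finset.sum_insert hi]
    linarith

/-! ### From random variables to laws, and the upper bound. -/

theorem integral_abs_add_sum_rpow {Ω Ω' : Type*} [MeasurableSpace Ω] [MeasurableSpace Ω']
    {P : Measure Ω} {P' : Measure Ω'} [IsProbabilityMeasure P'] {X : Ω → ℝ} {X' : Ω' → ℝ} {p : ℝ}
    (hp : 0 < p) {n : ℕ} {Y : Fin n → Ω' → ℝ} (hX : IdentDistrib X' X P' P)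
    (hY : ∀ i, AEMeasurable (Y i) P') (hind : IndepFun X' (fun ω i => Y i ω) P') :
    ∫ ω, |X' ω + ∑ i, Y i ω| ^ p ∂P' =
      ∫ w, |w| ^ p ∂((P.map X).conv (P'.map (∑ i, Y i))) := by
  have hsum : AEMeasurable (∑ i, Y i) P' := Finset.aemeasurable_sum _ fun j _ => hY j
  have hi : IndepFun X' (∑ i, Y i) P' := by
    have := hind.comp (φ := id) (ψ := fun y : Fin n → ℝ => ∑ i, y i) measurable_id (by fun_prop)
    have e : (fun y : Fin n → ℝ => ∑ i, y i) ∘ (fun ω i => Y i ω) = ∑ i, Y i := by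
      ext ω
      simp only [Finset.sum_apply, Function.comp_apply]
    rwa [e] at this
  have hrp : Continuous fun w : ℝ => |w| ^ p :=
    continuous_abs.rpow_const fun _ => Or.inr hp.le
  rw [← hX.map_eq, ← hi.map_add_eq_map_conv_map₀ hX.aemeasurable_fst hsum,
    integral_map (hX.aemeasurable_fst.add hsum) hrp.aestronglyMeasurable]
  simp

theorem map_add_sqrt_mul_gaussianReal {Ω : Type*} [MeasurableSpace Ω] {P : Measure Ω}
    [IsProbabilityMeasure P] {X : Ω → ℝ} (hX : AEMeasurable X P) (v : NNReal) :
    (P.prod (gaussianReal 0 1)).map (fun w => X w.1 + √v * w.2) =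
      (P.map X).conv (gaussianReal 0 v) := by
  have hi : IndepFun (fun w : Ω × ℝ => X w.1) (fun w => √v * w.2) (P.prod (gaussianReal 0 1)) :=
    indepFun_prod₀ (Y := fun z => √v * z) hX (by fun_prop)
  have hX1 : AEMeasurable (fun w : Ω × ℝ => X w.1) (P.prod (gaussianReal 0 1)) := hX.comp_fst
  have h := hi.map_add_eq_map_conv_map₀ hX1 (by fun_prop)
  have e1 : (P.prod (gaussianReal 0 1)).map (fun w => X w.1) = P.map X := by
    conv_rhs => rw [← (measurePreserving_fst (μ := P) (ν := gaussianReal 0 1)).map_eq]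
    rw [AEMeasurable.map_map_of_aemeasurable _ measurable_fst.aemeasurable]
    · rfl
    · rwa [(measurePreserving_fst (μ := P) (ν := gaussianReal 0 1)).map_eq]
  have e2 : (P.prod (gaussianReal 0 1)).map (fun w => √v * w.2) = gaussianReal 0 v := by
    have h2 := gaussianReal_map_const_mul (μ := 0) (v := 1) (√v)
    rw [← (measurePreserving_snd (μ := P) (ν := gaussianReal 0 1)).map_eq,
      Measure.map_map (by fun_prop) (by fun_prop)] at h2
    refine Eq.trans ?_ (h2.trans ?_)
    · rfl
    · congr 1
      · simp
      · ext; simp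
  rw [e1, e2] at h
  exact h

theorem memLp_add_mul_gaussian {Ω : Type*} [MeasurableSpace Ω] {P : Measure Ω}
    [IsProbabilityMeasure P] {X : Ω → ℝ} {p : ℝ} (hX : MemLp X (ENNReal.ofReal p) P) (t : ℝ) :
    MemLp (fun w : Ω × ℝ => X w.1 + t * w.2) (ENNReal.ofReal p) (P.prod (gaussianReal 0 1)) :=
  (hX.comp_fst _).add (((memLp_id_gaussianReal_ofReal 0 1 p).comp_snd P).const_mul t)

theorem integral_abs_add_sqrt_mul_gaussian {Ω : Type*} [MeasurableSpace Ω] {P : Measure Ω}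
    [IsProbabilityMeasure P] {X : Ω → ℝ} {p : ℝ} (hp : 0 < p) (hX : AEMeasurable X P)
    (v : NNReal) : ∫ w : Ω × ℝ, |X w.1 + √v * w.2| ^ p ∂(P.prod (gaussianReal 0 1)) =
      ∫ w, |w| ^ p ∂((P.map X).conv (gaussianReal 0 v)) := by
  have hrp : Continuous fun w : ℝ => |w| ^ p :=
    continuous_abs.rpow_const fun _ => Or.inr hp.le
  rw [← map_add_sqrt_mul_gaussianReal hX v, integral_map ?_ hrp.aestronglyMeasurable]
  have hX1 : AEMeasurable (fun w : Ω × ℝ => X w.1) (P.prod (gaussianReal 0 1)) := hX.comp_fst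
  fun_prop

theorem memLp_id_map {Ω : Type*} [MeasurableSpace Ω] {P : Measure Ω} {p : ENNReal} {X : Ω → ℝ}
    (hX : MemLp X p P) : MemLp id p (P.map X) := by
  rw [memLp_map_measure_iff (by fun_prop) (ae_measurable_of_memLp hX)]
  exact hX

theorem momentValuesLe_le {Ω : Type u} [MeasurableSpace Ω] (P : Measure Ω) [IsProbabilityMeasure P]
    (X : Ω → ℝ) {p A B : ℝ} (hp : 2 < p) (hp3 : p ≤ 3) (hB : 0 ≤ B)
    (hX : MemLp X (ENNReal.ofReal p) P) {r : ℝ} (hr : r ∈ momentValuesLe P X p A B) :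
    r ≤ A + ∫ w : Ω × ℝ, |X w.1 + √B * w.2| ^ p ∂(P.prod (gaussianReal 0 1)) := by
  obtain ⟨Ω', _, P', X', n, Y, _, hX', hY, hind, rfl⟩ := hr
  have hp0 : 0 < p := by linarith
  have hXm := ae_measurable_of_memLp hX
  have : IsProbabilityMeasure (P.map X) := Measure.isProbabilityMeasure_map hXm
  have hμ : MemLp id (ENNReal.ofReal p) (P.map X) := memLp_id_map hX
  set v : Fin n → NNReal := fun i => (∫ ω, Y i ω ^ 2 ∂P').toNNReal
  have hv : ∀ i, ∫ ω, Y i ω ^ 2 ∂P' = v i := fun i =>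
    (Real.coe_toNNReal _ (integral_nonneg fun ω => sq_nonneg _)).symm
  have hvB : ∑ i, v i ≤ B.toNNReal := by
    rw [← NNReal.coe_le_coe, NNReal.coe_sum, Real.coe_toNNReal B hB]
    simpa only [← hv] using hY.sum_sq
  have h1 := integral_abs_rpow_conv_map_sum_le hp hp3 hY.toIsCenteredIndepSeq hv Finset.univ
    (P.map X) hμ
  -- An independent Gaussian carrying the unused variance can only increase the moment.
  have h2 := integral_abs_rpow_le_conv hp
    (memLp_id_conv hμ (memLp_id_gaussianReal_ofReal 0 (∑ i, v i) p))
    (memLp_id_gaussianReal_ofReal 0 (B.toNNReal - ∑ i, v i) p) integral_id_gaussianReal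
  rw [Measure.conv_assoc, gaussianReal_zero_conv, add_tsub_cancel_of_le hvB,
    ← integral_abs_add_sqrt_mul_gaussian hp0 hXm B.toNNReal, Real.coe_toNNReal B hB] at h2
  rw [integral_abs_add_sum_rpow hp0 hX' (fun i => ae_measurable_of_memLp (hY.memLp i)) hind]
  linarith [hY.sum_abs_rpow]

theorem momentValuesEq_subset {Ω : Type u} [MeasurableSpace Ω] (P : Measure Ω) (X : Ω → ℝ)
    (p A B : ℝ) : momentValuesEq P X p A B ⊆ momentValuesLe P X p A B := by
  rintro r ⟨Ω', _, P', X', n, Y, hP, hX', hY, hind, rfl⟩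
  exact ⟨Ω', _, P', X', n, Y, hP, hX', ⟨hY.toIsCenteredIndepSeq, hY.sum_sq.le,
    hY.sum_abs_rpow.le⟩, hind, rfl⟩

/-! ### Sharpness: nearly extremal sequences. -/

theorem continuous_integral_abs_add_mul_gaussian {Ω : Type*} [MeasurableSpace Ω] {P : Measure Ω}
    [IsProbabilityMeasure P] {X : Ω → ℝ} {p : ℝ} (hp : 0 < p)
    (hX : MemLp X (ENNReal.ofReal p) P) : Continuous fun t : ℝ =>
      ∫ w : Ω × ℝ, |X w.1 + t * w.2| ^ p ∂(P.prod (gaussianReal 0 1)) := by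
  rw [continuous_iff_continuousAt]
  intro t₀
  have hint : ∀ t, Integrable (fun w : Ω × ℝ => |X w.1 + t * w.2| ^ p)
      (P.prod (gaussianReal 0 1)) := fun t =>
    MemLp.integrable_abs_rpow hp (memLp_add_mul_gaussian hX t)
  refine continuousAt_of_dominated (bound := fun w => |(|X w.1| + (|t₀| + 1) * |w.2|)| ^ p)
    (Filter.Eventually.of_forall fun t => (hint t).1) ?_ ?_ ?_
  · filter_upwards [Metric.ball_mem_nhds t₀ one_pos] with t ht
    refine Filter.Eventually.of_forall fun w => ?_
    rw [Metric.mem_ball, Real.dist_eq] at ht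
    have ht' : |t| ≤ |t₀| + 1 := by linarith [abs_sub_abs_le_abs_sub t t₀]
    rw [Real.norm_of_nonneg (by positivity)]
    refine Real.rpow_le_rpow (abs_nonneg _) ?_ hp.le
    refine ((abs_add_le _ _).trans ?_).trans (le_abs_self _)
    rw [abs_mul]
    gcongr
  · exact MemLp.integrable_abs_rpow hp ((hX.abs.comp_fst _).add
      (((memLp_id_gaussianReal_ofReal 0 1 p).abs.comp_snd P).const_mul _))
  · refine Filter.Eventually.of_forall fun w => Continuous.continuousAt ?_
    exact (continuous_abs.comp (by fun_prop)).rpow_const fun _ => Or.inr hp.le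

/-- The symmetric law giving mass `θ / 2` to each of `M`, `-M` and mass `1 - θ` to `0`. -/
noncomputable def symmThreePoint (θ M : ℝ) : Measure ℝ :=
  ENNReal.ofReal (1 - θ) • Measure.dirac 0 +
    ENNReal.ofReal (θ / 2) • (Measure.dirac M + Measure.dirac (-M))

theorem isProbabilityMeasure_symmThreePoint {θ : ℝ} (h0 : 0 ≤ θ) (h1 : θ ≤ 1) (M : ℝ) :
    IsProbabilityMeasure (symmThreePoint θ M) := by
  constructor
  simp only [symmThreePoint, Measure.add_apply, Measure.smul_apply, measure_univ, smul_eq_mul,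
    mul_one]
  rw [mul_add, mul_one, ← ENNReal.ofReal_add (by linarith) (by linarith),
    ← ENNReal.ofReal_add (by linarith) (by linarith)]
  simp

theorem integral_symmThreePoint {θ : ℝ} (h0 : 0 ≤ θ) (h1 : θ ≤ 1) (M : ℝ) (f : ℝ → ℝ) :
    ∫ x, f x ∂symmThreePoint θ M = (1 - θ) * f 0 + θ / 2 * (f M + f (-M)) := by
  have i : ∀ a, Integrable f (Measure.dirac a) := fun a => integrable_dirac (by simp)
  rw [symmThreePoint, integral_add_measure ((i 0).smul_measure (by simp))
    (((i M).add_measure (i (-M))).smul_measure (by simp)), integral_smul_measure,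
    integral_smul_measure, integral_add_measure (i M) (i (-M))]
  simp only [integral_dirac, smul_eq_mul]
  rw [ENNReal.toReal_ofReal (by linarith), ENNReal.toReal_ofReal (by linarith)]

theorem memLp_id_symmThreePoint {θ : ℝ} (h0 : 0 ≤ θ) (h1 : θ ≤ 1) (M : ℝ) (p : ENNReal) :
    MemLp id p (symmThreePoint θ M) := by
  have := isProbabilityMeasure_symmThreePoint h0 h1 M
  refine MemLp.of_bound (by fun_prop) |M| ?_
  simp only [symmThreePoint]
  rw [ae_add_measure_iff]
  constructor
  · exact Measure.ae_smul_measure (by simp) _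
  · refine Measure.ae_smul_measure ?_ _
    rw [ae_add_measure_iff]
    simp

/-- By convexity, the average of `|x + M|^p` and `|x - M|^p` is at least `|M|^p`, whatever `x` is.
-/
theorem integral_abs_rpow_conv_symmThreePoint_ge {μ : Measure ℝ} [IsProbabilityMeasure μ]
    {p θ M : ℝ} (hp : 1 ≤ p) (hμ : MemLp id (ENNReal.ofReal p) μ) (h0 : 0 ≤ θ) (h1 : θ ≤ 1) :
    (1 - θ) * ∫ w, |w| ^ p ∂μ + θ * |M| ^ p ≤ ∫ w, |w| ^ p ∂(μ.conv (symmThreePoint θ M)) := by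
  have hp0 : 0 < p := by linarith
  have := isProbabilityMeasure_symmThreePoint h0 h1 M
  have i1 : Integrable (fun w : ℝ => |w| ^ p) (μ.conv (symmThreePoint θ M)) :=
    MemLp.integrable_abs_rpow hp0 (memLp_id_conv hμ (memLp_id_symmThreePoint h0 h1 M _))
  have j1 : Integrable (fun x => ∫ y, |x + y| ^ p ∂symmThreePoint θ M) μ :=
    (i1.comp_measurable (f := fun z : ℝ × ℝ => z.1 + z.2) (by fun_prop)).integral_prod_left
  have k : Integrable (fun w : ℝ => |w| ^ p) μ := MemLp.integrable_abs_rpow hp0 hμ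
  rw [integral_conv_eq i1]
  have h := integral_mono (f := fun w => (1 - θ) * |w| ^ p + θ * |M| ^ p) (by fun_prop) j1
    fun x => ?_
  · rw [integral_add (by fun_prop) (by fun_prop), integral_const_mul] at h
    simpa using h
  · rw [integral_symmThreePoint h0 h1 M fun y => |x + y| ^ p]
    have hc := (convexOn_abs_rpow hp).2 (Set.mem_univ (x + M)) (Set.mem_univ (-(x + -M)))
      (by norm_num : (0 : ℝ) ≤ 1 / 2) (by norm_num : (0 : ℝ) ≤ 1 / 2) (by norm_num)
    simp only [smul_eq_mul, abs_neg] at hc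
    rw [show 1 / 2 * (x + M) + 1 / 2 * -(x + -M) = M by ring] at hc
    have := mul_le_mul_of_nonneg_left hc h0
    simp only [add_zero]
    linarith

section Product

variable {Ω : Type u} [MeasurableSpace Ω] (P : Measure Ω) [IsProbabilityMeasure P] {n : ℕ}
  (ν : Fin n → Measure ℝ) [∀ i, IsProbabilityMeasure (ν i)]

theorem map_prod_pi_eval (i : Fin n) :
    (P.prod (Measure.pi ν)).map (fun w => w.2 i) = ν i :=
  ((measurePreserving_eval ν i).comp (measurePreserving_snd (μ := P))).map_eq

theorem iIndepFun_prod_pi :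
    iIndepFun (fun (i : Fin n) (w : Ω × (Fin n → ℝ)) => w.2 i) (P.prod (Measure.pi ν)) := by
  rw [iIndepFun_iff_map_fun_eq_pi_map (fun i => by fun_prop)]
  simp only [map_prod_pi_eval]
  exact (measurePreserving_snd (μ := P) (ν := Measure.pi ν)).map_eq

/-- The sequence is realised by the coordinates of `Ω × ℝⁿ`, which stays in the universe of `Ω`. -/
theorem mem_momentValuesEq_of_laws {p A B : ℝ} (hp : 0 < p) {X : Ω → ℝ}
    (hX : AEMeasurable X P) (hν : ∀ i, MemLp id (ENNReal.ofReal p) (ν i))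
    (hm : ∀ i, ∫ x, x ∂ν i = 0) (hB : ∑ i, ∫ x, x ^ 2 ∂ν i = B)
    (hA : ∑ i, ∫ x, |x| ^ p ∂ν i = A) :
    ∫ w, |w| ^ p ∂((P.map X).conv ((P.prod (Measure.pi ν)).map
      (∑ i, fun w : Ω × (Fin n → ℝ) => w.2 i))) ∈ momentValuesEq P X p A B := by
  have hint : ∀ i (f : ℝ → ℝ), Continuous f →
      ∫ w, f (w.2 i) ∂(P.prod (Measure.pi ν)) = ∫ x, f x ∂ν i := by
    intro i f hf
    rw [← map_prod_pi_eval P ν i, integral_map (by fun_prop) hf.aestronglyMeasurable]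
  have hid : IdentDistrib (fun w : Ω × (Fin n → ℝ) => X w.1) X (P.prod (Measure.pi ν)) P := by
    refine ⟨hX.comp_fst, hX, ?_⟩
    conv_rhs => rw [← (measurePreserving_fst (μ := P) (ν := Measure.pi ν)).map_eq]
    rw [AEMeasurable.map_map_of_aemeasurable _ measurable_fst.aemeasurable]
    · rfl
    · rwa [(measurePreserving_fst (μ := P) (ν := Measure.pi ν)).map_eq]
  have hind : IndepFun (fun w : Ω × (Fin n → ℝ) => X w.1) (fun w i => w.2 i)
      (P.prod (Measure.pi ν)) :=
    indepFun_prod₀ (Y := fun y : Fin n → ℝ => y) hX aemeasurable_id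
  refine ⟨Ω × (Fin n → ℝ), inferInstance, P.prod (Measure.pi ν), fun w => X w.1, n,
    fun i w => w.2 i, inferInstance, hid, ⟨⟨fun i => ?_, fun i => ?_, iIndepFun_prod_pi P ν⟩,
    ?_, ?_⟩, hind, ?_⟩
  · have h := hν i
    rw [← map_prod_pi_eval P ν i, memLp_map_measure_iff (by fun_prop) (by fun_prop)] at h
    exact h
  · rw [hint i (fun x => x) continuous_id, hm i]
  · rw [← hB]
    exact Finset.sum_congr rfl fun i _ => hint i (fun x => x ^ 2) (by fun_prop)
  · rw [← hA]
    exact Finset.sum_congr rfl fun i _ => hint i (fun x => |x| ^ p)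
      (continuous_abs.rpow_const fun _ => Or.inr hp.le)
  · exact (integral_abs_add_sum_rpow hp hid (fun i => by fun_prop) hind).symm

end Product

theorem map_sum_gaussian {Ω : Type*} [MeasurableSpace Ω] {P : Measure Ω} [IsProbabilityMeasure P]
    {ι : Type*} [DecidableEq ι] {Y : ι → Ω → ℝ} (hY : ∀ i, AEMeasurable (Y i) P)
    (hind : iIndepFun Y P) {v : NNReal} {s : Finset ι}
    (hs : ∀ i ∈ s, P.map (Y i) = gaussianReal 0 v) :
    P.map (∑ i ∈ s, Y i) = gaussianReal 0 (s.card * v) := by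
  induction s using Finset.induction_on with
  | empty => rw [map_sum_empty]; simp
  | insert i s hi ih =>
    rw [map_sum_insert hY hind hi, ih fun j hj => hs j (Finset.mem_insert_of_mem hj),
      hs i (Finset.mem_insert_self i s), gaussianReal_zero_conv, Finset.card_insert_of_notMem hi]
    push_cast
    rw [add_mul, one_mul]

theorem integral_abs_rpow_gaussianReal {p : ℝ} (hp : 0 < p) (v : NNReal) :
    ∫ x, |x| ^ p ∂gaussianReal 0 v = (v : ℝ) ^ (p / 2) * ∫ x, |x| ^ p ∂gaussianReal 0 1 := by
  have h := gaussianReal_map_const_mul (μ := 0) (v := 1) (√v)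
  have e : NNReal.mk (√v ^ 2) (sq_nonneg _) * 1 = v := by ext; simp
  rw [mul_zero, e] at h
  rw [← h, integral_map (by fun_prop)
    (continuous_abs.rpow_const fun _ => Or.inr hp.le).aestronglyMeasurable, ← integral_const_mul]
  congr 1 with x
  rw [abs_mul, abs_of_nonneg (Real.sqrt_nonneg _), Real.mul_rpow (Real.sqrt_nonneg _)
    (abs_nonneg _), Real.sqrt_eq_rpow, ← Real.rpow_mul v.coe_nonneg]
  congr 2
  ring

/-- With `n` Gaussians of variance `δ` and a symmetric three-point variable of variance `δ`, where
`(n + 1) * δ = B`, the moment is at least `(1 - θ) E |X + √(B - δ) Z| ^ p + a`. -/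
theorem exists_momentValuesEq_ge {Ω : Type u} [MeasurableSpace Ω] (P : Measure Ω)
    [IsProbabilityMeasure P] {X : Ω → ℝ} {p A B : ℝ} (hp : 2 < p)
    (hX : MemLp X (ENNReal.ofReal p) P) {n : ℕ} {δ a θ : ℝ} (hδ : 0 < δ)
    (hB : (n + 1) * δ = B)
    (ha : A - (B - δ) * δ ^ (p / 2 - 1) * ∫ x, |x| ^ p ∂gaussianReal 0 1 = a) (ha0 : 0 < a)
    (hθ : δ * (δ / a) ^ (2 / (p - 2)) = θ) (hθ1 : θ ≤ 1) :
    ∃ r ∈ momentValuesEq P X p A B, (1 - θ) *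
      ∫ w : Ω × ℝ, |X w.1 + √(B - δ) * w.2| ^ p ∂(P.prod (gaussianReal 0 1)) + a ≤ r := by
  have hp0 : 0 < p := by linarith
  have hp2 : 0 < p - 2 := by linarith
  have hXm := ae_measurable_of_memLp hX
  have : IsProbabilityMeasure (P.map X) := Measure.isProbabilityMeasure_map hXm
  have hμ : MemLp id (ENNReal.ofReal p) (P.map X) := memLp_id_map hX
  have hθ0 : 0 ≤ θ := by rw [← hθ]; positivity
  -- The jump must satisfy `θ M^2 = δ` and `θ M^p = a`, which forces `M^(p-2) = a / δ`. Here `a` is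
  -- what remains of `A` after the Gaussians have used `n δ^(p/2) E|Z|^p`, with `n δ = B - δ`.
  set M := (a / δ) ^ (1 / (p - 2)) with hM
  have hM0 : 0 < M := by positivity
  have hMp : M ^ (p - 2) = a / δ := by
    rw [hM, ← Real.rpow_mul (by positivity), one_div_mul_cancel hp2.ne', Real.rpow_one]
  have hθM2 : θ * M ^ 2 = δ := by
    rw [← hθ, hM, ← Real.rpow_two, ← Real.rpow_mul (by positivity), mul_assoc,
      show 1 / (p - 2) * 2 = 2 / (p - 2) by ring, ← Real.mul_rpow (by positivity) (by positivity),
      show δ / a * (a / δ) = 1 by field_simp, Real.one_rpow, mul_one]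
  have hθMp : θ * M ^ p = a := by
    rw [show M ^ p = M ^ 2 * M ^ (p - 2) by
      rw [← Real.rpow_two, ← Real.rpow_add hM0]; congr 1; ring, ← mul_assoc, hθM2, hMp]
    field_simp
  have := isProbabilityMeasure_symmThreePoint hθ0 hθ1 M
  set v : NNReal := NNReal.mk δ hδ.le
  set ν : Fin (n + 1) → Measure ℝ := Fin.cons (symmThreePoint θ M) fun _ => gaussianReal 0 v
    with hν
  have hν0 : ν 0 = symmThreePoint θ M := rfl
  have hνs : ∀ i : Fin n, ν i.succ = gaussianReal 0 v := fun i => rfl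
  have hprob : ∀ i, IsProbabilityMeasure (ν i) := by
    refine Fin.cases ?_ fun i => ?_
    · rwa [hν0]
    · rw [hνs]; infer_instance
  refine ⟨_, mem_momentValuesEq_of_laws P ν hp0 hXm ?_ ?_ ?_ ?_, ?_⟩
  · refine Fin.cases ?_ fun i => ?_
    · rw [hν0]; exact memLp_id_symmThreePoint hθ0 hθ1 M _
    · rw [hνs]; exact memLp_id_gaussianReal_ofReal 0 v p
  · refine Fin.cases ?_ fun i => ?_
    · rw [hν0, integral_symmThreePoint hθ0 hθ1 M fun x => x]
      ring
    · rw [hνs, integral_id_gaussianReal]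
  · rw [Fin.sum_univ_succ, hν0, integral_symmThreePoint hθ0 hθ1 M fun x => x ^ 2]
    simp only [hνs, integral_sq_gaussianReal, Finset.sum_const, Finset.card_univ,
      Fintype.card_fin, nsmul_eq_mul]
    rw [← hB]
    change _ + n * δ = _
    linear_combination hθM2
  · rw [Fin.sum_univ_succ, hν0, integral_symmThreePoint hθ0 hθ1 M fun x => |x| ^ p]
    simp only [hνs, integral_abs_rpow_gaussianReal hp0 v, Finset.sum_const, Finset.card_univ,
      Fintype.card_fin, nsmul_eq_mul, abs_neg, abs_zero, Real.zero_rpow hp0.ne', abs_of_pos hM0]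
    change _ + n * (δ ^ (p / 2) * _) = _
    have e : δ ^ (p / 2) = δ * δ ^ (p / 2 - 1) := by
      rw [Real.rpow_sub_one hδ.ne']; field_simp
    rw [e]
    rw [← hB] at ha
    linear_combination hθMp - ha
  · have hY : ∀ i : Fin (n + 1), AEMeasurable (fun w : Ω × (Fin (n + 1) → ℝ) => w.2 i)
      (P.prod (Measure.pi ν)) := fun i => by fun_prop
    have hs := map_sum_insert hY (iIndepFun_prod_pi P ν)
      (Finset.notMem_erase (0 : Fin (n + 1)) Finset.univ)
    rw [Finset.insert_erase (Finset.mem_univ _), map_prod_pi_eval, hν0,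
      map_sum_gaussian (v := v) (s := Finset.univ.erase 0) hY (iIndepFun_prod_pi P ν) ?_] at hs
    · obtain ⟨b, hb⟩ : ∃ b : NNReal, (b : ℝ) = B - δ :=
        ⟨n * v, by change (n : ℝ) * δ = _; linarith⟩
      have hc : ((Finset.univ.erase (0 : Fin (n + 1))).card : NNReal) * v = b := by
        ext
        rw [Finset.card_erase_of_mem (Finset.mem_univ _), hb]
        simp only [Finset.card_univ, Fintype.card_fin, Nat.add_sub_cancel]
        change (n : ℝ) * δ = B - δ
        linarith
      have hg := integral_abs_rpow_conv_symmThreePoint_ge (M := M) (by linarith : 1 ≤ p)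
        (memLp_id_conv hμ (memLp_id_gaussianReal_ofReal 0 b p)) hθ0 hθ1
      rw [abs_of_pos hM0, hθMp, ← integral_abs_add_sqrt_mul_gaussian hp0 hXm, hb] at hg
      rwa [hs, hc, ← Measure.conv_assoc]
    · intro i hi
      rw [map_prod_pi_eval]
      obtain ⟨j, rfl⟩ := Fin.exists_succ_eq.2 (Finset.ne_of_mem_erase hi)
      exact hνs j

open Filter Topology in
-- With `δ = B / (n + 1)` tending to `0`, the Gaussian share of `A` vanishes, so `a → A` and `θ →
-- 0`; continuity in the scale of the Gaussian gives the limit.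
theorem le_of_mem_upperBounds_momentValuesEq {Ω : Type u} [MeasurableSpace Ω] (P : Measure Ω)
    [IsProbabilityMeasure P] {X : Ω → ℝ} {p A B : ℝ} (hp : 2 < p) (hA : 0 < A) (hB : 0 < B)
    (hX : MemLp X (ENNReal.ofReal p) P) {u : ℝ} (hu : u ∈ upperBounds (momentValuesEq P X p A B)) :
    A + ∫ w : Ω × ℝ, |X w.1 + √B * w.2| ^ p ∂(P.prod (gaussianReal 0 1)) ≤ u := by
  have hp0 : 0 < p := by linarith
  have hp2 : 0 < p - 2 := by linarith
  set m := ∫ x, |x| ^ p ∂gaussianReal 0 1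
  set G : ℝ → ℝ := fun t => ∫ w : Ω × ℝ, |X w.1 + t * w.2| ^ p ∂(P.prod (gaussianReal 0 1))
  have hG : Continuous G := continuous_integral_abs_add_mul_gaussian hp0 hX
  set δ : ℕ → ℝ := fun n => B / (n + 1) with hδ
  have hδ0 : Tendsto δ atTop (𝓝 0) := by
    simpa [hδ, div_eq_mul_inv] using (tendsto_one_div_add_atTop_nhds_zero_nat (𝕜 := ℝ)).const_mul B
  set a : ℕ → ℝ := fun n => A - (B - δ n) * δ n ^ (p / 2 - 1) * m with ha
  have ha0 : Tendsto a atTop (𝓝 A) := by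
    have h1 := hδ0.rpow_const (p := p / 2 - 1) (Or.inr (by linarith))
    rw [Real.zero_rpow (by linarith)] at h1
    have h2 := (((hδ0.const_sub B).mul h1).mul_const m).const_sub A
    simpa using h2
  set θ : ℕ → ℝ := fun n => δ n * (δ n / a n) ^ (2 / (p - 2)) with hθ
  have hθ0 : Tendsto θ atTop (𝓝 0) := by
    have h1 := (hδ0.div ha0 hA.ne').rpow_const (p := 2 / (p - 2)) (Or.inr (by positivity))
    have h2 := hδ0.mul h1
    simpa using h2
  have hlim : Tendsto (fun n => (1 - θ n) * G (√(B - δ n)) + a n) atTop (𝓝 (A + G (√B))) := by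
    have h1 : Tendsto (fun n => G (√(B - δ n))) atTop (𝓝 (G (√B))) := by
      refine (hG.tendsto _).comp ((Real.continuous_sqrt.tendsto _).comp ?_)
      simpa using hδ0.const_sub B
    have h2 := ((hθ0.const_sub 1).mul h1).add ha0
    simpa [add_comm] using h2
  refine le_of_tendsto hlim ?_
  -- The construction needs `a > 0` and `θ ≤ 1`, which hold only for large `n`.
  filter_upwards [ha0.eventually_const_lt hA, hθ0.eventually_le_const one_pos] with n hn1 hn2
  obtain ⟨r, hr, hle⟩ := exists_momentValuesEq_ge P (A := A) (B := B) hp hX (n := n) (δ := δ n)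
    (by simp only [hδ]; positivity) (by simp only [hδ]; field_simp) rfl hn1 rfl hn2
  exact hle.trans (hu hr)

theorem theorem2 {Ω : Type u} [MeasurableSpace Ω] (P : Measure Ω) [IsProbabilityMeasure P]
    (X : Ω → ℝ) (p A B : ℝ) (hp : 2 < p) (hp' : p ≤ 3) (hA : 0 < A) (hB : 0 < B)
    (hX : MemLp X (ENNReal.ofReal p) P) :
    Integrable (fun w : Ω × ℝ => |X w.1 + √B * w.2| ^ p) (P.prod (gaussianReal 0 1)) ∧
    IsLUB (momentValuesLe P X p A B)
      (A + ∫ w : Ω × ℝ, |X w.1 + √B * w.2| ^ p ∂(P.prod (gaussianReal 0 1))) ∧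
    IsLUB (momentValuesEq P X p A B)
      (A + ∫ w : Ω × ℝ, |X w.1 + √B * w.2| ^ p ∂(P.prod (gaussianReal 0 1))) := by
  have hsub := momentValuesEq_subset P X p A B
  have hle : A + ∫ w : Ω × ℝ, |X w.1 + √B * w.2| ^ p ∂(P.prod (gaussianReal 0 1)) ∈
      upperBounds (momentValuesLe P X p A B) := fun r hr =>
    momentValuesLe_le P X hp hp' hB.le hX hr
  exact ⟨MemLp.integrable_abs_rpow (by linarith) (memLp_add_mul_gaussian hX _),
    ⟨hle, fun u hu => le_of_mem_upperBounds_momentValuesEq P hp hA hB hX fun r hr => hu (hsub hr)⟩,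
    ⟨fun r hr => hle (hsub hr), fun u hu =>
      le_of_mem_upperBounds_momentValuesEq P hp hA hB hX hu⟩⟩
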